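/- Let $r, L \ge 1$ and $K_i, N_i \ge 1$ ($i = 1,\dots,r$) be integers and put $K = \max_i K_i$, $N = \max_i N_i$. Let $B_i \in \mathbb{C}^{L \times K_i}$ be deterministic matrices with $B_i^* B_i = \mathrm{Id}$, and let $C_i \in \mathbb{C}^{L \times N_i}$ be random matrices such that all entries of $C_1, \dots, C_r$ are jointly independent and have the circular-symmetric complex normal distribution $\mathcal{CN}(0,1)$, i.e. their real and imaginary parts are independent real Gaussians with mean $0$ and variance $1/2$. For $\ell = 1, \dots, L$ let $b_{i,\ell} \in \mathbb{C}^{K_i}$ be the $\ell$-th column of $B_i^*$ and let $c_{i,\ell} \in \mathbb{C}^{N_i}$ be the $\ell$-th row of $C_i$, written as a column vector. Let $\mathcal{M}$ be the space of tuples $Z = (Z_1, \dots, Z_r)$ with $Z_i \in \mathbb{C}^{K_i \times N_i}$, with norm $\|Z\|_F^2 = \sum_{i=1}^r \|Z_i\|_F^2$, where $\|Z_i\|_F$ is the Frobenius norm. Define the random linear operator \[ \mathcal{A} : \mathcal{M} \to \mathbb{C}^L, \qquad \mathcal{A}(Z) = \Big( \sum_{i=1}^r b_{i,\ell}^* Z_i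 c_{i,\ell} \Big)_{\ell=1}^L, \] and let $\|\mathcal{A}\|_{F \to 2}$ be its operator norm with respect to $\|\cdot\|_F$ on $\mathcal{M}$ and the Euclidean norm on $\mathbb{C}^L$. Put $\mu_i^2 = \max_{1 \le \ell \le L} \frac{L}{K_i} \|b_{i,\ell}\|_{\ell_2}^2$ and $K_\mu = \max_{1 \le i \le r} K_i \mu_i^2$. Let $\omega \ge 1$ be a real number. Then with probability at least $1 - 2 L^{-\omega}$, \[ \|\mathcal{A}\|_{F \to 2} \le 2 \sqrt{ \omega \, \max\Big\{ 1, \frac{r K_\mu N}{L} \Big\} \, \log_2 (L + rKN) }. \] -/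

import Mathlib

open MeasureTheory ProbabilityTheory

open scoped NNReal Matrix

namespace BlindDemixing

/-- The circular-symmetric complex normal distribution `𝒞𝒩(0, v)`: real and imaginary part are
independent centred real Gaussians of variance `v / 2`. -/
noncomputable def complexNormal (v : ℝ≥0) : Measure ℂ :=
  ((gaussianReal 0 (v / 2)).prod (gaussianReal 0 (v / 2))).map
    fun p : ℝ × ℝ => (p.1 : ℂ) + (p.2 : ℂ) * Complex.I

/-- The space `ℂ^{k × n}` of `k × n` matrices with the Frobenius norm, i.e. the Euclidean norm of
the family of entries `Z (a, b)`. -/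
abbrev FrobMatrix (k n : ℕ) : Type := EuclideanSpace ℂ (Fin k × Fin n)

/-- The matrix with entries `Z (a, b)`. -/
def FrobMatrix.toMatrix {k n : ℕ} (Z : FrobMatrix k n) : Matrix (Fin k) (Fin n) ℂ :=
  Matrix.of fun a b => Z (a, b)

/-- The space `ℳ` of tuples `Z = (Z₁, …, Z_r)` with `Z_i ∈ ℂ^{K_i × N_i}`, normed by
`‖Z‖_F ^ 2 = ∑ i, ‖Z_i‖_F ^ 2`. -/
abbrev LiftedSpace {r : ℕ} (K N : Fin r → ℕ) : Type :=
  PiLp 2 fun i : Fin r => FrobMatrix (K i) (N i)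

/-- `b_ℓ`, the `ℓ`-th column of `B*`. -/
noncomputable def bVec {L k : ℕ} (B : Matrix (Fin L) (Fin k) ℂ) (l : Fin L) :
    EuclideanSpace ℂ (Fin k) :=
  WithLp.toLp 2 fun j => Bᴴ j l

/-- `c_ℓ`, the `ℓ`-th row of `C`, regarded as a (column) vector in `ℂ^n`. -/
noncomputable def cVec {L n : ℕ} (C : Matrix (Fin L) (Fin n) ℂ) (l : Fin L) :
    EuclideanSpace ℂ (Fin n) :=
  WithLp.toLp 2 fun j => C l j

/-- The operator `𝒜_i : ℂ^{k × n} → ℂ^L`, `Z ↦ (b_ℓ* Z c_ℓ)_ℓ`. -/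
noncomputable def blockOp {L k n : ℕ} (B : Matrix (Fin L) (Fin k) ℂ)
    (C : Matrix (Fin L) (Fin n) ℂ) : FrobMatrix k n →ₗ[ℂ] EuclideanSpace ℂ (Fin L) where
  toFun Z := WithLp.toLp 2 fun l => star (bVec B l).ofLp ⬝ᵥ (Z.toMatrix *ᵥ (cVec C l).ofLp)
  map_add' Z W := by
    have h : (Z + W).toMatrix = Z.toMatrix + W.toMatrix := rfl
    ext l
    simp [h, Matrix.add_mulVec, dotProduct_add]
  map_smul' a Z := by
    have h : (a • Z).toMatrix = a • Z.toMatrix := rfl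
    ext l
    simp [h, Matrix.smul_mulVec, dotProduct_smul]

/-- The operator `𝒜 : ℳ → ℂ^L`, `𝒜(Z) = ∑ i, 𝒜_i(Z_i)`, as a continuous linear map, so that
`‖measurementOp B C‖` is the operator norm `‖𝒜‖_{F → 2}`. -/
noncomputable def measurementOp {r L : ℕ} {K N : Fin r → ℕ}
    (B : ∀ i, Matrix (Fin L) (Fin (K i)) ℂ) (C : ∀ i, Matrix (Fin L) (Fin (N i)) ℂ) :
    LiftedSpace K N →L[ℂ] EuclideanSpace ℂ (Fin L) :=
  LinearMap.toContinuousLinearMap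
    (∑ i, blockOp (B i) (C i) ∘ₗ PiLp.projₗ 2 (fun i => FrobMatrix (K i) (N i)) i)

/-- The largest of finitely many dimensions. -/
def maxDim {r : ℕ} (d : Fin r → ℕ) : ℕ := Finset.univ.sup d

/-- The coherence parameter `μ² = max_ℓ (L / k) ‖b_ℓ‖²` of `B ∈ ℂ^{L × k}`. -/
noncomputable def coherenceSq {L k : ℕ} (B : Matrix (Fin L) (Fin k) ℂ) : ℝ :=
  ⨆ l : Fin L, (L : ℝ) / (k : ℝ) * ‖bVec B l‖ ^ 2

/-- `K_μ = max_i K_i μ_i²`. -/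
noncomputable def maxCoherence {r L : ℕ} {K : Fin r → ℕ}
    (B : ∀ i, Matrix (Fin L) (Fin (K i)) ℂ) : ℝ :=
  ⨆ i : Fin r, (K i : ℝ) * coherenceSq (B i)

end BlindDemixing

namespace BlindDemixing

/-! In coordinates `𝒜` is a Gaussian matrix series `M = ∑ c_q A_q` with `A_q = coeffMatrix B q`.
Here `∑ A_q* A_q = 1` since the `B i` are isometries, and `∑ A_q A_q*` is diagonal with entries `∑
i, N_i ‖b_{i,l}‖²`, at most `r K_μ N / L`. So `s = max 1 (r K_μ N / L)` dominates both.

The core is the moment bound `E tr (M M*)^p ≤ p! s^p L` (`integral_re_trace_pow_le`), by induction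
on `p`. Gaussian integration by parts in the first factor gives the terms `tr (A_q (M*M)^k A_q*
(MM*)^(p-1-k))`. In eigenbases of `M*M` and `MM*`, a rearrangement inequality moves all powers to
one side of `A_q`, where the variance bounds yield `p s tr (MM*)^(p-1)` (`sum_trace_le`).

The factor `p!` is absorbed by the exponential series, so `E exp(‖M‖² / 2s) ≤ 2L`. Markov's
inequality at `‖M‖² ≥ 4 w s log₂ d`, with `d = L + rKN`, then leaves probability at most `2L exp(-2w
log₂ d) ≤ 2 L^(-w)`. -/

/-! ### Integration by parts for a real Gaussian. -/

lemma integrable_pow_gaussianReal (v : ℝ≥0) (n : ℕ) :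
    Integrable (fun x : ℝ => (x : ℂ) ^ n) (gaussianReal 0 v) := by
  have h := (memLp_id_gaussianReal (μ := 0) (v := v) n).integrable_norm_pow'
  refine h.mono' (by fun_prop) (Filter.Eventually.of_forall fun x => ?_)
  simp

lemma integrable_polynomial_gaussianReal (v : ℝ≥0) (p : Polynomial ℂ) :
    Integrable (fun x : ℝ => p.eval (x : ℂ)) (gaussianReal 0 v) := by
  simp_rw [Polynomial.eval_eq_sum_range]
  exact integrable_finsetSum _ fun i _ => (integrable_pow_gaussianReal v i).const_mul _

/-- Gaussian integration by parts for polynomials. -/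
lemma integral_mul_polynomial_gaussianReal (v : ℝ≥0) (p : Polynomial ℂ) :
    ∫ x : ℝ, (x : ℂ) * p.eval (x : ℂ) ∂gaussianReal 0 v
      = v * ∫ x : ℝ, p.derivative.eval (x : ℂ) ∂gaussianReal 0 v := by
  rcases eq_or_ne v 0 with rfl | hv
  · simp
  have hv' : (v : ℝ) ≠ 0 := by exact_mod_cast hv
  have hint : ∀ q : Polynomial ℂ,
      Integrable fun x : ℝ => gaussianPDFReal 0 v x • q.eval (x : ℂ) := by
    intro q
    have h := integrable_polynomial_gaussianReal v q
    rw [gaussianReal_of_var_ne_zero _ hv,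
      integrable_withDensity_iff_integrable_smul' (measurable_gaussianPDF 0 v)
        (Filter.Eventually.of_forall fun _ => gaussianPDF_lt_top)] at h
    simpa [toReal_gaussianPDF] using h
  have hpdf : ∀ x : ℝ, HasDerivAt (fun y : ℝ => ((gaussianPDFReal 0 v y : ℝ) : ℂ))
      (((-(x / v) * gaussianPDFReal 0 v x : ℝ)) : ℂ) x := by
    intro x
    refine HasDerivAt.ofReal_comp ?_
    simp only [gaussianPDFReal_def]
    have h1 : HasDerivAt (fun y : ℝ => -(y - 0) ^ 2 / (2 * (v : ℝ))) (-(x / v)) x := by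
      have := ((((hasDerivAt_id x).sub_const 0).pow 2).neg).div_const (2 * (v : ℝ))
      refine this.congr_deriv ?_
      simp
      field_simp
    refine (h1.exp.const_mul _).congr_deriv ?_
    ring
  have hp : ∀ x : ℝ, HasDerivAt (fun y : ℝ => p.eval (y : ℂ)) (p.derivative.eval (x : ℂ)) x :=
    fun x => (p.hasDerivAt (x : ℂ)).comp_ofReal
  -- The density `φ` satisfies `φ' = -(x / v) φ`, so multiplying by `x` amounts to applying `-v
  -- d/dx` to `φ`.
  have key := integral_mul_deriv_eq_deriv_mul_of_integrable
    (u := fun x : ℝ => p.eval (x : ℂ)) (u' := fun x : ℝ => p.derivative.eval (x : ℂ))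
    (v := fun y : ℝ => ((gaussianPDFReal 0 v y : ℝ) : ℂ))
    (v' := fun x : ℝ => (((-(x / v) * gaussianPDFReal 0 v x : ℝ)) : ℂ))
    (fun x _ => hp x) (fun x _ => hpdf x) ?_ ?_ ?_
  · rw [integral_gaussianReal_eq_integral_smul hv, integral_gaussianReal_eq_integral_smul hv]
    have e1 : ∀ x : ℝ, gaussianPDFReal 0 v x • ((x : ℂ) * p.eval (x : ℂ))
        = -(v : ℂ) * (p.eval (x : ℂ) * ((-(x / v) * gaussianPDFReal 0 v x : ℝ) : ℂ)) := by
      intro x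
      have : (v : ℂ) ≠ 0 := by exact_mod_cast hv'
      rw [Complex.real_smul]
      push_cast
      field_simp
    simp_rw [e1, integral_const_mul, key, Complex.real_smul]
    simp [mul_comm]
  · refine ((hint (Polynomial.X * p)).const_mul (-(1 / v) : ℂ)).congr
      (Filter.Eventually.of_forall fun x => ?_)
    simp [Complex.real_smul]
    ring
  · refine (hint p.derivative).congr (Filter.Eventually.of_forall fun x => ?_)
    simp [Complex.real_smul, mul_comm]
  · refine (hint p).congr (Filter.Eventually.of_forall fun x => ?_)
    simp [Complex.real_smul, mul_comm]

/-! ### Mixed moments of the complex normal distribution. -/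

instance isProbabilityMeasure_complexNormal (v : ℝ≥0) :
    IsProbabilityMeasure (complexNormal v) := by
  unfold complexNormal
  exact Measure.isProbabilityMeasure_map (by fun_prop)

lemma integrable_prod_gaussianReal (v : ℝ≥0) (a b : ℕ) :
    Integrable (fun p : ℝ × ℝ => ((p.1 : ℂ) + p.2 * Complex.I) ^ a
      * ((p.1 : ℂ) - p.2 * Complex.I) ^ b) ((gaussianReal 0 v).prod (gaussianReal 0 v)) := by
  have hX : MemLp (fun p : ℝ × ℝ => (p.1 : ℂ)) (a + b : ℕ)
      ((gaussianReal 0 v).prod (gaussianReal 0 v)) := by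
    have h := (memLp_id_gaussianReal (μ := 0) (v := v) (a + b : ℕ)).comp_fst (gaussianReal 0 v)
    refine MemLp.of_le (g := fun p : ℝ × ℝ => p.1) ?_ (by fun_prop)
      (Filter.Eventually.of_forall fun p => by simp)
    exact_mod_cast h
  have hY : MemLp (fun p : ℝ × ℝ => (p.2 : ℂ) * Complex.I) (a + b : ℕ)
      ((gaussianReal 0 v).prod (gaussianReal 0 v)) := by
    have h := (memLp_id_gaussianReal (μ := 0) (v := v) (a + b : ℕ)).comp_snd (gaussianReal 0 v)
    refine MemLp.of_le (g := fun p : ℝ × ℝ => p.2) ?_ (by fun_prop)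
      (Filter.Eventually.of_forall fun p => by simp)
    exact_mod_cast h
  refine (hX.add hY).integrable_norm_pow'.mono' (by fun_prop)
    (Filter.Eventually.of_forall fun p => le_of_eq ?_)
  have : ‖(p.1 : ℂ) - p.2 * Complex.I‖ = ‖(p.1 : ℂ) + p.2 * Complex.I‖ := by
    rw [← RCLike.norm_conj]
    simp [sub_eq_add_neg]
  simp [this, pow_add]

lemma integrable_complexNormal (v : ℝ≥0) (a b : ℕ) :
    Integrable (fun z : ℂ => z ^ a * (star z) ^ b) (complexNormal v) := by
  unfold complexNormal
  rw [integrable_map_measure (by fun_prop) (by fun_prop)]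
  refine (integrable_prod_gaussianReal (v / 2) a b).congr
    (Filter.Eventually.of_forall fun p => ?_)
  simp [sub_eq_add_neg]

/-- Expand one factor as `z = x + iy` and integrate by parts in each variable: the operator `∂_x + i
∂_y` annihilates powers of `z` and sends `z̄ ^ b` to `2b z̄ ^ (b - 1)`. For `b = 0` the truncated
exponent is harmless, its coefficient being `0`. -/
lemma integral_prod_gaussianReal_succ (v : ℝ≥0) (a b : ℕ) :
    ∫ p : ℝ × ℝ, ((p.1 : ℂ) + p.2 * Complex.I) ^ (a + 1) * ((p.1 : ℂ) - p.2 * Complex.I) ^ b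
        ∂(gaussianReal 0 v).prod (gaussianReal 0 v)
      = 2 * v * b * ∫ p : ℝ × ℝ, ((p.1 : ℂ) + p.2 * Complex.I) ^ a
          * ((p.1 : ℂ) - p.2 * Complex.I) ^ (b - 1)
        ∂(gaussianReal 0 v).prod (gaussianReal 0 v) := by
  set γ := gaussianReal 0 v
  have hF := integrable_prod_gaussianReal v
  have h1 : Integrable (fun p : ℝ × ℝ => (p.1 : ℂ) * (((p.1 : ℂ) + p.2 * Complex.I) ^ a
      * ((p.1 : ℂ) - p.2 * Complex.I) ^ b)) (γ.prod γ) := by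
    refine (((hF (a + 1) b).add (hF a (b + 1))).const_mul (1 / 2 : ℂ)).congr
      (Filter.Eventually.of_forall fun p => ?_)
    simp only [Pi.add_apply]
    ring
  have h2 : Integrable (fun p : ℝ × ℝ => (p.2 : ℂ) * (((p.1 : ℂ) + p.2 * Complex.I) ^ a
      * ((p.1 : ℂ) - p.2 * Complex.I) ^ b)) (γ.prod γ) := by
    refine (((hF (a + 1) b).sub (hF a (b + 1))).const_mul (-Complex.I / 2 : ℂ)).congr
      (Filter.Eventually.of_forall fun p => ?_)
    simp only [Pi.sub_apply]
    ring_nf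
    simp only [Complex.I_sq]
    ring
  have hlin : ∀ c d : ℂ, Integrable (fun p : ℝ × ℝ => c * (((p.1 : ℂ) + p.2 * Complex.I) ^ (a - 1)
      * ((p.1 : ℂ) - p.2 * Complex.I) ^ b) + d * (((p.1 : ℂ) + p.2 * Complex.I) ^ a
      * ((p.1 : ℂ) - p.2 * Complex.I) ^ (b - 1))) (γ.prod γ) :=
    fun c d => ((hF (a - 1) b).const_mul c).add ((hF a (b - 1)).const_mul d)
  have e1 : ∫ p : ℝ × ℝ, (p.1 : ℂ) * (((p.1 : ℂ) + p.2 * Complex.I) ^ a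
      * ((p.1 : ℂ) - p.2 * Complex.I) ^ b) ∂γ.prod γ
      = v * ∫ p : ℝ × ℝ, (a * (((p.1 : ℂ) + p.2 * Complex.I) ^ (a - 1)
          * ((p.1 : ℂ) - p.2 * Complex.I) ^ b) + b * (((p.1 : ℂ) + p.2 * Complex.I) ^ a
          * ((p.1 : ℂ) - p.2 * Complex.I) ^ (b - 1))) ∂γ.prod γ := by
    rw [integral_prod_symm _ h1, integral_prod_symm _ (hlin _ _), ← integral_const_mul]
    congr 1
    ext y
    have := integral_mul_polynomial_gaussianReal v
      ((Polynomial.X + Polynomial.C (y * Complex.I)) ^ a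
        * (Polynomial.X - Polynomial.C (y * Complex.I)) ^ b)
    simp only [Polynomial.derivative_mul, Polynomial.derivative_pow, Polynomial.eval_add,
      Polynomial.eval_mul, Polynomial.eval_pow, Polynomial.eval_sub, Polynomial.eval_X,
      Polynomial.eval_C, Polynomial.derivative_add, Polynomial.derivative_sub,
      Polynomial.derivative_X, Polynomial.derivative_C, add_zero, sub_zero, mul_one] at this
    rw [this]
    congr 2
    ext x
    ring
  have e2 : ∫ p : ℝ × ℝ, (p.2 : ℂ) * (((p.1 : ℂ) + p.2 * Complex.I) ^ a
      * ((p.1 : ℂ) - p.2 * Complex.I) ^ b) ∂γ.prod γ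
      = v * ∫ p : ℝ × ℝ, (a * Complex.I * (((p.1 : ℂ) + p.2 * Complex.I) ^ (a - 1)
          * ((p.1 : ℂ) - p.2 * Complex.I) ^ b) + -(b * Complex.I) *
          (((p.1 : ℂ) + p.2 * Complex.I) ^ a
          * ((p.1 : ℂ) - p.2 * Complex.I) ^ (b - 1))) ∂γ.prod γ := by
    rw [integral_prod _ h2, integral_prod _ (hlin _ _), ← integral_const_mul]
    congr 1
    ext x
    have := integral_mul_polynomial_gaussianReal v
      ((Polynomial.C (x : ℂ) + Polynomial.X * Polynomial.C Complex.I) ^ a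
        * (Polynomial.C (x : ℂ) - Polynomial.X * Polynomial.C Complex.I) ^ b)
    simp only [Polynomial.derivative_mul, Polynomial.derivative_pow, Polynomial.eval_add,
      Polynomial.eval_mul, Polynomial.eval_pow, Polynomial.eval_sub, Polynomial.eval_X,
      Polynomial.eval_C, Polynomial.derivative_add, Polynomial.derivative_sub,
      Polynomial.derivative_X, Polynomial.derivative_C, zero_add, zero_sub, one_mul,
      mul_zero, add_zero, Polynomial.eval_neg] at this
    rw [this]
    congr 2
    ext x
    ring
  have e0 : ∀ p : ℝ × ℝ, ((p.1 : ℂ) + p.2 * Complex.I) ^ (a + 1)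
      * ((p.1 : ℂ) - p.2 * Complex.I) ^ b
      = (p.1 : ℂ) * (((p.1 : ℂ) + p.2 * Complex.I) ^ a * ((p.1 : ℂ) - p.2 * Complex.I) ^ b)
        + Complex.I * ((p.2 : ℂ) * (((p.1 : ℂ) + p.2 * Complex.I) ^ a
          * ((p.1 : ℂ) - p.2 * Complex.I) ^ b)) := fun p => by ring
  simp_rw [e0]
  rw [integral_add h1 (h2.const_mul _), integral_const_mul, e1, e2,
    integral_add ((hF (a - 1) b).const_mul _) ((hF a (b - 1)).const_mul _),
    integral_add ((hF (a - 1) b).const_mul _) ((hF a (b - 1)).const_mul _)]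
  simp only [integral_const_mul]
  -- Since `I² = -1`, the two `a`-terms cancel and the two `b`-terms add up.
  linear_combination (v : ℂ) * (a * (∫ p : ℝ × ℝ, ((p.1 : ℂ) + p.2 * Complex.I) ^ (a - 1)
    * ((p.1 : ℂ) - p.2 * Complex.I) ^ b ∂γ.prod γ) - b * (∫ p : ℝ × ℝ,
    ((p.1 : ℂ) + p.2 * Complex.I) ^ a * ((p.1 : ℂ) - p.2 * Complex.I) ^ (b - 1) ∂γ.prod γ))
    * Complex.I_sq

/-- The recursion for the mixed moments of the complex normal distribution. -/
lemma integral_complexNormal_succ (v : ℝ≥0) (a b : ℕ) :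
    ∫ z : ℂ, z ^ (a + 1) * (star z) ^ b ∂complexNormal v
      = v * b * ∫ z : ℂ, z ^ a * (star z) ^ (b - 1) ∂complexNormal v := by
  unfold complexNormal
  rw [integral_map (by fun_prop) (by fun_prop), integral_map (by fun_prop) (by fun_prop)]
  have h := integral_prod_gaussianReal_succ (v / 2) a b
  have e : ∀ p : ℝ × ℝ, star ((p.1 : ℂ) + p.2 * Complex.I) = (p.1 : ℂ) - p.2 * Complex.I := by
    intro p
    simp [sub_eq_add_neg]
  simp_rw [e, h]
  push_cast
  ring

/-! ### Trace inequalities in eigenbases. -/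

section MatrixTrace

open scoped ComplexOrder

variable {m n ι : Type*} [Fintype m] [Fintype n] [DecidableEq m] [DecidableEq n] [Fintype ι]

lemma pow_eq_unitary_conj_diagonal {P : Matrix m m ℂ} (hP : P.IsHermitian) (k : ℕ) :
    P ^ k = (hP.eigenvectorUnitary : Matrix m m ℂ)
      * Matrix.diagonal (fun a => ((hP.eigenvalues a ^ k : ℝ) : ℂ))
      * (hP.eigenvectorUnitary : Matrix m m ℂ)ᴴ := by
  conv_lhs => rw [hP.spectral_theorem, ← map_pow, Matrix.diagonal_pow]
  rw [Unitary.conjStarAlgAut_apply]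
  congr 3
  ext a
  simp

/-- The weights are the squared moduli of the entries of `A` in the two eigenbases. They do not
depend on `k` and `l`, so inequalities between monomials in the eigenvalues lift to traces. -/
lemma trace_mul_pow_mul_pow_eq {P : Matrix m m ℂ} {Q : Matrix n n ℂ} (hP : P.IsHermitian)
    (hQ : Q.IsHermitian) (A : Matrix m n ℂ) :
    ∃ W : m → n → ℝ, (∀ a b, 0 ≤ W a b) ∧ ∀ k l : ℕ, (A * Q ^ k * Aᴴ * P ^ l).trace.re
      = ∑ a, ∑ b, W a b * (hQ.eigenvalues b ^ k * hP.eigenvalues a ^ l) := by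
  set U := (hP.eigenvectorUnitary : Matrix m m ℂ)
  set V := (hQ.eigenvectorUnitary : Matrix n n ℂ)
  refine ⟨fun a b => Complex.normSq ((Uᴴ * A * V) a b), fun a b => Complex.normSq_nonneg _,
    fun k l => ?_⟩
  rw [pow_eq_unitary_conj_diagonal hP, pow_eq_unitary_conj_diagonal hQ]
  set D := Matrix.diagonal (fun a => ((hQ.eigenvalues a ^ k : ℝ) : ℂ))
  set E := Matrix.diagonal (fun a => ((hP.eigenvalues a ^ l : ℝ) : ℂ))
  have h : (A * (V * D * Vᴴ) * Aᴴ * (U * E * Uᴴ)).trace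
      = ((Uᴴ * A * V) * D * (Uᴴ * A * V)ᴴ * E).trace := by
    rw [← Matrix.mul_assoc _ _ Uᴴ, Matrix.trace_mul_comm]
    simp only [Matrix.conjTranspose_mul, Matrix.conjTranspose_conjTranspose, Matrix.mul_assoc]
  rw [h]
  generalize Uᴴ * A * V = G
  rw [Matrix.trace, Complex.re_sum]
  refine Finset.sum_congr rfl fun a _ => ?_
  rw [Matrix.diag_apply, Matrix.mul_diagonal, Matrix.mul_apply, Finset.sum_mul, Complex.re_sum]
  refine Finset.sum_congr rfl fun b _ => ?_
  rw [Matrix.mul_diagonal, Matrix.conjTranspose_apply]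
  have : ∀ (z : ℂ) (x y : ℝ), (z * x * star z * y).re = Complex.normSq z * (x * y) := by
    intro z x y
    have : z * x * star z * y = ((Complex.normSq z * (x * y) : ℝ) : ℂ) := by
      push_cast
      rw [← Complex.mul_conj]
      simp only [Complex.star_def]
      ring
    rw [this, Complex.ofReal_re]
  exact this _ _ _

lemma re_trace_mul_nonneg {P Q : Matrix m m ℂ} (hP : P.PosSemidef) (hQ : Q.PosSemidef) :
    0 ≤ (Q * P).trace.re := by
  obtain ⟨W, hW, h⟩ := trace_mul_pow_mul_pow_eq hP.isHermitian hQ.isHermitian 1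
  have := h 1 1
  simp only [pow_one, Matrix.one_mul, Matrix.conjTranspose_one, Matrix.mul_one] at this
  rw [this]
  exact Finset.sum_nonneg fun a _ => Finset.sum_nonneg fun b _ =>
    mul_nonneg (hW a b) (mul_nonneg (hQ.eigenvalues_nonneg b) (hP.eigenvalues_nonneg a))

/-- The difference of the two sides is `(x^k - y^k)(x^l - y^l)`, whose factors have the same sign.
-/
lemma pow_mul_pow_add_le {x y : ℝ} (hx : 0 ≤ x) (hy : 0 ≤ y) (k l : ℕ) :
    x ^ k * y ^ l + x ^ l * y ^ k ≤ x ^ (k + l) * y ^ 0 + x ^ 0 * y ^ (k + l) := by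
  have : 0 ≤ (x ^ k - y ^ k) * (x ^ l - y ^ l) := by
    rcases le_total x y with h | h
    · exact mul_nonneg_of_nonpos_of_nonpos (sub_nonpos.2 (pow_le_pow_left₀ hx h k))
        (sub_nonpos.2 (pow_le_pow_left₀ hx h l))
    · exact mul_nonneg (sub_nonneg.2 (pow_le_pow_left₀ hy h k))
        (sub_nonneg.2 (pow_le_pow_left₀ hy h l))
  rw [pow_add, pow_add]
  linarith

/-- Pair index `k` with `N - k`: each pair is bounded by the two extreme terms. Summing over all `k`
counts every term twice, hence the `1 / 2`. -/
lemma sum_trace_mul_pow_mul_pow_le {P : Matrix m m ℂ} {Q : Matrix n n ℂ} (hP : P.PosSemidef)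
    (hQ : Q.PosSemidef) (A : Matrix m n ℂ) (N : ℕ) :
    ∑ k ∈ Finset.range (N + 1), (A * Q ^ k * Aᴴ * P ^ (N - k)).trace.re
      ≤ (N + 1) / 2 * ((A * Q ^ N * Aᴴ).trace.re + (A * Aᴴ * P ^ N).trace.re) := by
  obtain ⟨W, hW, h⟩ := trace_mul_pow_mul_pow_eq hP.isHermitian hQ.isHermitian A
  set x : ℕ → ℝ := fun k => (A * Q ^ k * Aᴴ * P ^ (N - k)).trace.re with hx
  have hpair : ∀ k ∈ Finset.range (N + 1), x k + x (N - k) ≤ x N + x 0 := by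
    intro k hk
    have hk' : k ≤ N := Nat.lt_succ_iff.1 (Finset.mem_range.1 hk)
    simp only [hx, h, ← Finset.sum_add_distrib, ← mul_add]
    refine Finset.sum_le_sum fun a _ => Finset.sum_le_sum fun b _ =>
      mul_le_mul_of_nonneg_left ?_ (hW a b)
    have := pow_mul_pow_add_le (hQ.eigenvalues_nonneg b) (hP.eigenvalues_nonneg a) k (N - k)
    rw [Nat.add_sub_cancel' hk'] at this
    rwa [Nat.sub_sub_self hk', Nat.sub_self, Nat.sub_zero]
  have hflip := Finset.sum_flip x (n := N)
  have hsum := Finset.sum_le_sum hpair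
  rw [Finset.sum_add_distrib, hflip, Finset.sum_const, Finset.card_range, nsmul_eq_mul] at hsum
  push_cast at hsum
  have e1 : x N = (A * Q ^ N * Aᴴ).trace.re := by simp [hx]
  have e0 : x 0 = (A * Aᴴ * P ^ N).trace.re := by simp [hx]
  rw [← e1, ← e0]
  linarith

/-- Cyclicity of the trace for a rectangular `M`. The exponent must be positive: at `0` the traces
are the two dimensions. -/
lemma trace_pow_succ_comm (M : Matrix m n ℂ) (k : ℕ) :
    ((Mᴴ * M) ^ (k + 1)).trace = ((M * Mᴴ) ^ (k + 1)).trace := by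
  have h : ∀ k : ℕ, M * (Mᴴ * M) ^ k = (M * Mᴴ) ^ k * M := by
    intro k
    induction k with
    | zero => simp
    | succ k ih => rw [pow_succ, ← Matrix.mul_assoc, ih, pow_succ]; simp only [Matrix.mul_assoc]
  rw [pow_succ', Matrix.mul_assoc, h, Matrix.trace_mul_comm, pow_succ, Matrix.mul_assoc]

lemma sum_trace_le (A : ι → Matrix m n ℂ) (s : ℝ)
    (h1 : ((s : ℂ) • (1 : Matrix m m ℂ) - ∑ q, A q * (A q)ᴴ).PosSemidef)
    (h2 : ((s : ℂ) • (1 : Matrix n n ℂ) - ∑ q, (A q)ᴴ * A q).PosSemidef)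
    (M : Matrix m n ℂ) (N : ℕ) :
    ∑ q, ∑ k ∈ Finset.range (N + 1),
        (A q * (Mᴴ * M) ^ k * (A q)ᴴ * (M * Mᴴ) ^ (N - k)).trace.re
      ≤ (N + 1) * (s * ((M * Mᴴ) ^ N).trace.re) := by
  have hP := Matrix.posSemidef_self_mul_conjTranspose M
  have hQ := Matrix.posSemidef_conjTranspose_mul_self M
  set P := M * Mᴴ
  set Q := Mᴴ * M
  have b1 : ∑ q, (A q * (A q)ᴴ * P ^ N).trace.re ≤ s * (P ^ N).trace.re := by
    have := re_trace_mul_nonneg (hP.pow N) h1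
    rw [Matrix.sub_mul, Matrix.smul_mul, Matrix.one_mul, Matrix.sum_mul, Matrix.trace_sub,
      Matrix.trace_smul, Matrix.trace_sum, Complex.sub_re, Complex.re_sum, smul_eq_mul,
      Complex.re_ofReal_mul] at this
    linarith
  have b2 : ∑ q, (A q * Q ^ N * (A q)ᴴ).trace.re ≤ s * (P ^ N).trace.re := by
    -- For `N = 0` the trace of `1` over `n` would be the wrong dimension, so cyclicity reduces the
    -- claim to `b1`, which bounds by the trace over `m`.
    rcases N with _ | N
    · simpa using b1
    · have := re_trace_mul_nonneg (hQ.pow (N + 1)) h2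
      rw [Matrix.sub_mul, Matrix.smul_mul, Matrix.one_mul, Matrix.sum_mul, Matrix.trace_sub,
        Matrix.trace_smul, Matrix.trace_sum, Complex.sub_re, Complex.re_sum, smul_eq_mul,
        Complex.re_ofReal_mul, trace_pow_succ_comm] at this
      have e : ∀ q, (A q * Q ^ (N + 1) * (A q)ᴴ).trace = ((A q)ᴴ * A q * Q ^ (N + 1)).trace :=
        fun q => by rw [Matrix.trace_mul_comm, Matrix.mul_assoc]
      simp_rw [e]
      linarith
  calc _ ≤ ∑ q, ((N : ℝ) + 1) / 2 * ((A q * Q ^ N * (A q)ᴴ).trace.re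
        + (A q * (A q)ᴴ * P ^ N).trace.re) :=
        Finset.sum_le_sum fun q _ => sum_trace_mul_pow_mul_pow_le hP hQ (A q) N
    _ = ((N : ℝ) + 1) / 2 * (∑ q, (A q * Q ^ N * (A q)ᴴ).trace.re
        + ∑ q, (A q * (A q)ᴴ * P ^ N).trace.re) := by
        rw [← Finset.mul_sum, Finset.sum_add_distrib]
    _ ≤ ((N : ℝ) + 1) / 2 * (s * (P ^ N).trace.re + s * (P ^ N).trace.re) := by gcongr
    _ = _ := by ring

end MatrixTrace

/-! ### Integration by parts for polynomials in `z` and `z̄`, treated as independent indeterminates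
so that `pderiv` is a Wirtinger derivative. -/

section WickCalculus

open MvPolynomial

variable {ι : Type*} [Fintype ι]

/-- The point at which a polynomial in `z` and `z̄` is evaluated. -/
noncomputable def conjPoint (c : ι → ℂ) : ι ⊕ ι → ℂ := Sum.elim c fun q => star (c q)

lemma eval_conjPoint_monomial (c : ι → ℂ) (d : ι ⊕ ι →₀ ℕ) (a : ℂ) :
    eval (conjPoint c) (monomial d a)
      = a * ∏ q, (c q ^ d (Sum.inl q) * star (c q) ^ d (Sum.inr q)) := by
  rw [eval_monomial, Finsupp.prod_fintype _ _ fun _ => pow_zero _, Fintype.prod_sum_type,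
    Finset.prod_mul_distrib]
  rfl

lemma integrable_eval_conjPoint (v : ℝ≥0) (p : MvPolynomial (ι ⊕ ι) ℂ) :
    Integrable (fun c : ι → ℂ => eval (conjPoint c) p)
      (Measure.pi fun _ : ι => complexNormal v) := by
  induction p using MvPolynomial.induction_on' with
  | monomial d a =>
    simp_rw [eval_conjPoint_monomial]
    exact (Integrable.fintype_prod (f := fun q z => z ^ d (Sum.inl q) * star z ^ d (Sum.inr q))
      fun q => integrable_complexNormal v _ _).const_mul a
  | add p q hp hq =>
    simp_rw [map_add]
    exact hp.add hq

lemma integral_eval_conjPoint_monomial (v : ℝ≥0) (d : ι ⊕ ι →₀ ℕ) (a : ℂ) :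
    ∫ c : ι → ℂ, eval (conjPoint c) (monomial d a) ∂Measure.pi (fun _ : ι => complexNormal v)
      = a * ∏ q, ∫ z : ℂ, z ^ d (Sum.inl q) * star z ^ d (Sum.inr q) ∂complexNormal v := by
  simp_rw [eval_conjPoint_monomial, integral_const_mul]
  rw [integral_fintype_prod_eq_prod fun q z => z ^ d (Sum.inl q) * star z ^ d (Sum.inr q)]

variable [DecidableEq ι]

/-- Integration by parts for independent complex normal random variables. -/
lemma integral_eval_X_mul (v : ℝ≥0) (q : ι) (p : MvPolynomial (ι ⊕ ι) ℂ) :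
    ∫ c : ι → ℂ, eval (conjPoint c) (X (Sum.inl q) * p)
        ∂Measure.pi (fun _ : ι => complexNormal v)
      = (v : ℂ) * ∫ c : ι → ℂ, eval (conjPoint c) (pderiv (Sum.inr q) p)
        ∂Measure.pi (fun _ : ι => complexNormal v) := by
  induction p using MvPolynomial.induction_on' with
  | monomial d a =>
    rw [X, monomial_mul, pderiv_monomial, integral_eval_conjPoint_monomial,
      integral_eval_conjPoint_monomial, ← Finset.mul_prod_erase _ _ (Finset.mem_univ q),
      ← Finset.mul_prod_erase _ _ (Finset.mem_univ q)]
    -- By independence the integral factorizes, and only the factor at `q` changes; there the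
    -- one-variable recursion applies.
    have h : ∀ q' ∈ Finset.univ.erase q,
        ∫ z : ℂ, z ^ (Finsupp.single (Sum.inl q) 1 + d : ι ⊕ ι →₀ ℕ) (Sum.inl q')
          * star z ^ (Finsupp.single (Sum.inl q) 1 + d : ι ⊕ ι →₀ ℕ) (Sum.inr q') ∂complexNormal v
        = ∫ z : ℂ, z ^ (d - Finsupp.single (Sum.inr q) 1 : ι ⊕ ι →₀ ℕ) (Sum.inl q')
          * star z ^ (d - Finsupp.single (Sum.inr q) 1 : ι ⊕ ι →₀ ℕ) (Sum.inr q')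
            ∂complexNormal v := by
      intro q' hq'
      have hne : q ≠ q' := (Finset.ne_of_mem_erase hq').symm
      simp [hne]
    rw [Finset.prod_congr rfl h]
    have h0 := integral_complexNormal_succ v (d (Sum.inl q)) (d (Sum.inr q))
    have e1 : (Finsupp.single (Sum.inl q) 1 + d : ι ⊕ ι →₀ ℕ) (Sum.inl q)
        = d (Sum.inl q) + 1 := by simp [add_comm]
    have e2 : (Finsupp.single (Sum.inl q) 1 + d : ι ⊕ ι →₀ ℕ) (Sum.inr q)
        = d (Sum.inr q) := by simp
    have e3 : (d - Finsupp.single (Sum.inr q) 1 : ι ⊕ ι →₀ ℕ) (Sum.inl q)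
        = d (Sum.inl q) := by simp
    have e4 : (d - Finsupp.single (Sum.inr q) 1 : ι ⊕ ι →₀ ℕ) (Sum.inr q)
        = d (Sum.inr q) - 1 := by simp
    rw [e1, e2, e3, e4, h0]
    ring
  | add p₁ p₂ h₁ h₂ =>
    simp_rw [mul_add, map_add]
    rw [integral_add (integrable_eval_conjPoint v _) (integrable_eval_conjPoint v _),
      integral_add (integrable_eval_conjPoint v _) (integrable_eval_conjPoint v _), h₁, h₂, mul_add]

end WickCalculus

/-! ### Trace moments of a Gaussian matrix series. -/

section MatrixSeries

open MvPolynomial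

open scoped ComplexOrder

lemma map_derivation_mul {R S l m n : Type*} [CommSemiring R] [CommSemiring S] [Algebra R S]
    [Fintype m] (D : Derivation R S S) (X : Matrix l m S) (Y : Matrix m n S) :
    (X * Y).map D = X.map D * Y + X * Y.map D := by
  ext i j
  simp only [Matrix.map_apply, Matrix.mul_apply, Matrix.add_apply, map_sum, Derivation.leibniz,
    smul_eq_mul, ← Finset.sum_add_distrib]
  exact Finset.sum_congr rfl fun k _ => by ring

variable {ι m n : Type*}

/-- A matrix regarded as a matrix of constant polynomials. -/
noncomputable def constMatrix (ι : Type*) (A : Matrix m n ℂ) : Matrix m n (MvPolynomial (ι ⊕ ι) ℂ) :=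
  A.map C

lemma constMatrix_map_eval (A : Matrix m n ℂ) (c : ι → ℂ) :
    (constMatrix ι A).map (eval (conjPoint c)) = A := by
  ext i j
  simp [constMatrix]

lemma constMatrix_map_pderiv (A : Matrix m n ℂ) (q : ι ⊕ ι) :
    (constMatrix ι A).map (pderiv q) = 0 := by
  ext i j
  simp [constMatrix]

variable [Fintype ι]

/-- The matrix series `∑ q, c q • A q` with indeterminate coefficients. -/
noncomputable def polySeries (A : ι → Matrix m n ℂ) :
    Matrix m n (MvPolynomial (ι ⊕ ι) ℂ) :=
  ∑ q, (X (Sum.inl q) : MvPolynomial (ι ⊕ ι) ℂ) • constMatrix ι (A q)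

/-- The conjugate transpose of `polySeries A`, with separate indeterminates for the conjugate
coefficients. -/
noncomputable def polySeriesStar (A : ι → Matrix m n ℂ) :
    Matrix n m (MvPolynomial (ι ⊕ ι) ℂ) :=
  ∑ q, (X (Sum.inr q) : MvPolynomial (ι ⊕ ι) ℂ) • constMatrix ι (A q)ᴴ

lemma polySeries_map_eval (A : ι → Matrix m n ℂ) (c : ι → ℂ) :
    (polySeries A).map (eval (conjPoint c)) = ∑ q, c q • A q := by
  ext i j
  simp [polySeries, constMatrix, Matrix.sum_apply, conjPoint]

lemma polySeriesStar_map_eval (A : ι → Matrix m n ℂ) (c : ι → ℂ) :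
    (polySeriesStar A).map (eval (conjPoint c)) = (∑ q, c q • A q)ᴴ := by
  ext i j
  simp [polySeriesStar, constMatrix, Matrix.sum_apply, conjPoint]

lemma polySeries_map_pderiv [DecidableEq ι] (A : ι → Matrix m n ℂ) (q : ι) :
    (polySeries A).map (pderiv (Sum.inr q)) = 0 := by
  ext i j
  simp [polySeries, constMatrix, Matrix.sum_apply, pderiv_X]

lemma polySeriesStar_map_pderiv [DecidableEq ι] (A : ι → Matrix m n ℂ) (q : ι) :
    (polySeriesStar A).map (pderiv (Sum.inr q)) = constMatrix ι (A q)ᴴ := by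
  ext i j
  simp [polySeriesStar, constMatrix, Matrix.sum_apply, pderiv_X, Pi.single_apply]

variable [Fintype m] [Fintype n] [DecidableEq m]

lemma eval_trace_polySeries_pow (A : ι → Matrix m n ℂ) (c : ι → ℂ) (N : ℕ) :
    eval (conjPoint c) ((polySeries A * polySeriesStar A) ^ N).trace
      = (((∑ q, c q • A q) * (∑ q, c q • A q)ᴴ) ^ N).trace := by
  rw [AddMonoidHom.map_trace, ← RingHom.mapMatrix_apply, map_pow, RingHom.mapMatrix_apply,
    Matrix.map_mul, polySeries_map_eval, polySeriesStar_map_eval]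

lemma integrable_trace_pow (A : ι → Matrix m n ℂ) (N : ℕ) :
    Integrable (fun c : ι → ℂ => (((∑ q, c q • A q) * (∑ q, c q • A q)ᴴ) ^ N).trace)
      (Measure.pi fun _ : ι => complexNormal 1) := by
  simp_rw [← eval_trace_polySeries_pow]
  exact integrable_eval_conjPoint 1 _

variable [DecidableEq n]

lemma eval_trace_polySeries (A : ι → Matrix m n ℂ) (c : ι → ℂ) (q : ι) (k l : ℕ) :
    eval (conjPoint c) (constMatrix ι (A q) * ((polySeriesStar A * polySeries A) ^ k * constMatrix ι (A q)ᴴ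
        * (polySeries A * polySeriesStar A) ^ l)).trace
      = (A q * ((∑ q, c q • A q)ᴴ * (∑ q, c q • A q)) ^ k * (A q)ᴴ
        * ((∑ q, c q • A q) * (∑ q, c q • A q)ᴴ) ^ l).trace := by
  rw [AddMonoidHom.map_trace, Matrix.map_mul, Matrix.map_mul, Matrix.map_mul,
    ← RingHom.mapMatrix_apply _ (_ ^ k), ← RingHom.mapMatrix_apply _ (_ ^ l), map_pow, map_pow,
    RingHom.mapMatrix_apply, RingHom.mapMatrix_apply,
    Matrix.map_mul, Matrix.map_mul, polySeries_map_eval, polySeriesStar_map_eval, constMatrix_map_eval,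
    constMatrix_map_eval]
  simp only [Matrix.mul_assoc]

variable [DecidableEq ι]

/-- Leibniz rule over the `N + 1` factors `polySeriesStar A`; `polySeries A` contains no conjugate
indeterminates and contributes nothing. -/
lemma pderiv_polySeriesStar_mul_pow (A : ι → Matrix m n ℂ) (q : ι) (N : ℕ) :
    (polySeriesStar A * (polySeries A * polySeriesStar A) ^ N).map (pderiv (Sum.inr q))
      = ∑ k ∈ Finset.range (N + 1), (polySeriesStar A * polySeries A) ^ k * constMatrix ι (A q)ᴴ
        * (polySeries A * polySeriesStar A) ^ (N - k) := by
  have hS := polySeriesStar_map_pderiv A q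
  have hT := polySeries_map_pderiv A q
  set S := polySeriesStar A
  set T := polySeries A
  have hpow : ∀ k : ℕ, S * (T * S) ^ k * T = (S * T) ^ (k + 1) := by
    intro k
    induction k with
    | zero => simp
    | succ k ih =>
      rw [pow_succ (S * T), ← ih, pow_succ]
      simp only [Matrix.mul_assoc]
  induction N with
  | zero => simp [hS]
  | succ N ih =>
    rw [pow_succ, ← Matrix.mul_assoc, ← Matrix.mul_assoc, map_derivation_mul, map_derivation_mul,
      ih, hT, hS, Matrix.mul_zero, add_zero, hpow, Finset.sum_range_succ _ (N + 1),
      Nat.sub_self, pow_zero, Matrix.mul_one, Matrix.sum_mul, Matrix.sum_mul]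
    congr 1
    refine Finset.sum_congr rfl fun k hk => ?_
    rw [Nat.succ_sub (Nat.lt_succ_iff.1 (Finset.mem_range.1 hk)), pow_succ]
    simp only [Matrix.mul_assoc]

/-- Expand only the first factor of the word in its coefficients `c q` and integrate each by parts
against the rest. -/
lemma integral_trace_pow_succ (A : ι → Matrix m n ℂ) (N : ℕ) :
    ∫ c : ι → ℂ, (((∑ q, c q • A q) * (∑ q, c q • A q)ᴴ) ^ (N + 1)).trace
        ∂Measure.pi (fun _ : ι => complexNormal 1)
      = ∫ c : ι → ℂ, ∑ q, ∑ k ∈ Finset.range (N + 1),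
          (A q * ((∑ q, c q • A q)ᴴ * (∑ q, c q • A q)) ^ k * (A q)ᴴ
            * ((∑ q, c q • A q) * (∑ q, c q • A q)ᴴ) ^ (N - k)).trace
        ∂Measure.pi (fun _ : ι => complexNormal 1) := by
  have h : ((polySeries A * polySeriesStar A) ^ (N + 1)).trace
      = ∑ q, X (Sum.inl q) * (constMatrix ι (A q) * (polySeriesStar A
        * (polySeries A * polySeriesStar A) ^ N)).trace := by
    rw [pow_succ', Matrix.mul_assoc]
    conv_lhs => rw [polySeries, Matrix.sum_mul]
    rw [Matrix.trace_sum]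
    refine Finset.sum_congr rfl fun q _ => ?_
    rw [Matrix.smul_mul, Matrix.trace_smul, smul_eq_mul]
    rfl
  simp_rw [← eval_trace_polySeries_pow, h, map_sum]
  rw [integral_finsetSum _ fun q _ => integrable_eval_conjPoint 1 _]
  simp_rw [integral_eval_X_mul]
  have hd : ∀ (q : ι) (Y : Matrix n m (MvPolynomial (ι ⊕ ι) ℂ)),
      pderiv (Sum.inr q) (constMatrix ι (A q) * Y).trace
        = (constMatrix ι (A q) * Y.map (pderiv (Sum.inr q))).trace := by
    intro q Y
    rw [AddMonoidHom.map_trace, map_derivation_mul, constMatrix_map_pderiv, Matrix.zero_mul,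
      zero_add]
  simp_rw [hd, pderiv_polySeriesStar_mul_pow, ← eval_trace_polySeries, Matrix.mul_sum,
    Matrix.trace_sum, ← map_sum (eval _) _ (Finset.range _)]
  rw [integral_finsetSum _ fun q _ => integrable_eval_conjPoint 1 _]
  simp

/-- The noncommutative Khintchine inequality for complex Gaussian matrix series. -/
theorem integral_re_trace_pow_le (A : ι → Matrix m n ℂ) (s : ℝ) (hs : 0 ≤ s)
    (h1 : ((s : ℂ) • (1 : Matrix m m ℂ) - ∑ q, A q * (A q)ᴴ).PosSemidef)
    (h2 : ((s : ℂ) • (1 : Matrix n n ℂ) - ∑ q, (A q)ᴴ * A q).PosSemidef) (N : ℕ) :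
    ∫ c : ι → ℂ, (((∑ q, c q • A q) * (∑ q, c q • A q)ᴴ) ^ N).trace.re
        ∂Measure.pi (fun _ : ι => complexNormal 1)
      ≤ N.factorial * s ^ N * Fintype.card m := by
  induction N with
  | zero => simp
  | succ N ih =>
    have hint : Integrable (fun c : ι → ℂ => ∑ q, ∑ k ∈ Finset.range (N + 1),
        (A q * ((∑ q, c q • A q)ᴴ * (∑ q, c q • A q)) ^ k * (A q)ᴴ
          * ((∑ q, c q • A q) * (∑ q, c q • A q)ᴴ) ^ (N - k)).trace)
        (Measure.pi fun _ : ι => complexNormal 1) := by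
      simp_rw [← eval_trace_polySeries, ← map_sum]
      exact integrable_eval_conjPoint 1 _
    have hre : ∀ {f : (ι → ℂ) → ℂ}, Integrable f (Measure.pi fun _ : ι => complexNormal 1) →
        ∫ c, (f c).re ∂Measure.pi (fun _ : ι => complexNormal 1)
          = (∫ c, f c ∂Measure.pi (fun _ : ι => complexNormal 1)).re :=
      fun hf => integral_re hf
    rw [hre (integrable_trace_pow A _), integral_trace_pow_succ, ← hre hint]
    -- The trace inequality holds pointwise in `c`. Each induction step costs `(N + 1) s`, which
    -- accumulates to `N! s^N`.
    calc _ ≤ ∫ c : ι → ℂ, (N + 1) * (s * (((∑ q, c q • A q) * (∑ q, c q • A q)ᴴ) ^ N).trace.re)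
          ∂Measure.pi (fun _ : ι => complexNormal 1) := by
          refine integral_mono hint.re
            (((integrable_trace_pow A N).re.const_mul _).const_mul _) fun c => ?_
          simp only [Complex.re_sum]
          exact sum_trace_le A s h1 h2 _ N
      _ = (N + 1) * (s * ∫ c : ι → ℂ, (((∑ q, c q • A q) * (∑ q, c q • A q)ᴴ) ^ N).trace.re
          ∂Measure.pi (fun _ : ι => complexNormal 1)) := by
          rw [integral_const_mul, integral_const_mul]
      _ ≤ (N + 1) * (s * (N.factorial * s ^ N * Fintype.card m)) := by gcongr
      _ = _ := by
          rw [Nat.factorial_succ]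
          push_cast
          ring

end MatrixSeries

/-! ### From trace moments to a tail bound. -/

section Tail

open scoped ComplexOrder Matrix.Norms.L2Operator

variable {ι m n : Type*} [Fintype ι] [Fintype m] [Fintype n] [DecidableEq m] [DecidableEq n]

/-- `‖M‖²` is at most the largest eigenvalue of `M * Mᴴ`, and its `p`-th power is one of the
nonnegative summands of the trace. -/
lemma sq_l2_opNorm_pow_le_trace [Nonempty m] (M : Matrix m n ℂ) (p : ℕ) :
    (‖M‖ ^ 2) ^ p ≤ ((M * Mᴴ) ^ p).trace.re := by
  have hP := Matrix.posSemidef_self_mul_conjTranspose M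
  have hnorm : ‖M‖ ^ 2 = ‖M * Mᴴ‖ := by
    have h := Matrix.l2_opNorm_conjTranspose_mul_self Mᴴ
    rw [Matrix.conjTranspose_conjTranspose, Matrix.l2_opNorm_conjTranspose] at h
    rw [h, sq]
  rw [hnorm]
  set P := M * Mᴴ
  have htr : (P ^ p).trace.re = ∑ a, hP.isHermitian.eigenvalues a ^ p := by
    rw [pow_eq_unitary_conj_diagonal hP.isHermitian, Matrix.trace_mul_comm, ← Matrix.mul_assoc,
      ← Matrix.star_eq_conjTranspose, Unitary.coe_star_mul_self, Matrix.one_mul,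
      Matrix.trace_diagonal, Complex.re_sum]
    exact Finset.sum_congr rfl fun a _ => Complex.ofReal_re _
  obtain ⟨a₀, ha₀⟩ := Finite.exists_max hP.isHermitian.eigenvalues
  have hle : ‖P‖ ≤ hP.isHermitian.eigenvalues a₀ := by
    have h := pow_eq_unitary_conj_diagonal hP.isHermitian 1
    rw [pow_one] at h
    refine (congrArg norm h).trans_le ?_
    rw [← Matrix.star_eq_conjTranspose, ← Unitary.coe_star, CStarRing.norm_mul_coe_unitary,
      CStarRing.norm_coe_unitary_mul, Matrix.l2_opNorm_diagonal,
      pi_norm_le_iff_of_nonneg (hP.eigenvalues_nonneg a₀)]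
    intro a
    simpa [abs_of_nonneg (hP.eigenvalues_nonneg a)] using ha₀ a
  rw [htr]
  exact (pow_le_pow_left₀ (norm_nonneg _) hle p).trans
    (Finset.single_le_sum (f := fun a => hP.isHermitian.eigenvalues a ^ p)
      (fun a _ => pow_nonneg (hP.eigenvalues_nonneg a) p) (Finset.mem_univ a₀))

variable [DecidableEq ι] [Nonempty m] (A : ι → Matrix m n ℂ) {s : ℝ}

/-- Exponential moment of the squared operator norm of a complex Gaussian matrix series. -/
theorem lintegral_exp_sq_l2_opNorm_le (hs : 0 < s)
    (h1 : ((s : ℂ) • (1 : Matrix m m ℂ) - ∑ q, A q * (A q)ᴴ).PosSemidef)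
    (h2 : ((s : ℂ) • (1 : Matrix n n ℂ) - ∑ q, (A q)ᴴ * A q).PosSemidef) :
    ∫⁻ c : ι → ℂ, ENNReal.ofReal (Real.exp (‖∑ q, c q • A q‖ ^ 2 / (2 * s)))
        ∂Measure.pi (fun _ : ι => complexNormal 1)
      ≤ ENNReal.ofReal (2 * Fintype.card m) := by
  have hexp : ∀ c : ι → ℂ, ENNReal.ofReal (Real.exp (‖∑ q, c q • A q‖ ^ 2 / (2 * s)))
      = ∑' p : ℕ, ENNReal.ofReal ((‖∑ q, c q • A q‖ ^ 2 / (2 * s)) ^ p / p.factorial) := by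
    intro c
    have h := NormedSpace.expSeries_div_hasSum_exp (‖∑ q, c q • A q‖ ^ 2 / (2 * s))
    rw [Real.exp_eq_exp_ℝ, ← h.tsum_eq,
      ENNReal.ofReal_tsum_of_nonneg (fun p => by positivity) h.summable]
  have hmeas : Measurable fun c : ι → ℂ => ‖∑ q, c q • A q‖ :=
    (by fun_prop : Continuous fun c : ι → ℂ => ‖∑ q, c q • A q‖).measurable
  simp_rw [hexp]
  rw [lintegral_tsum fun p =>
    ((((hmeas.pow_const 2).div_const _).pow_const p).div_const _).ennreal_ofReal.aemeasurable]
  -- The moment's `p!` cancels that of the exponential series; the `2` in `2 * s` leaves a geometric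
  -- series of ratio `1 / 2`, whose sum is the `2` in the bound.
  have hterm : ∀ p : ℕ, ∫⁻ c : ι → ℂ,
      ENNReal.ofReal ((‖∑ q, c q • A q‖ ^ 2 / (2 * s)) ^ p / p.factorial)
        ∂Measure.pi (fun _ : ι => complexNormal 1)
      ≤ ENNReal.ofReal ((1 / 2) ^ p * Fintype.card m) := by
    intro p
    have hnn : ∀ c : ι → ℂ, 0 ≤ (((∑ q, c q • A q) * (∑ q, c q • A q)ᴴ) ^ p).trace.re :=
      fun c => (pow_nonneg (sq_nonneg _) p).trans (sq_l2_opNorm_pow_le_trace _ p)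
    calc _ ≤ ∫⁻ c : ι → ℂ, ENNReal.ofReal (1 / ((2 * s) ^ p * p.factorial)
          * (((∑ q, c q • A q) * (∑ q, c q • A q)ᴴ) ^ p).trace.re)
          ∂Measure.pi (fun _ : ι => complexNormal 1) := by
          refine lintegral_mono fun c => ENNReal.ofReal_le_ofReal ?_
          rw [div_pow, div_div, div_eq_mul_one_div, mul_comm]
          exact mul_le_mul_of_nonneg_left (sq_l2_opNorm_pow_le_trace _ p) (by positivity)
      _ = ENNReal.ofReal (1 / ((2 * s) ^ p * p.factorial) * ∫ c : ι → ℂ,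
          (((∑ q, c q • A q) * (∑ q, c q • A q)ᴴ) ^ p).trace.re
          ∂Measure.pi (fun _ : ι => complexNormal 1)) := by
          have hint : Integrable (fun c : ι → ℂ =>
              (((∑ q, c q • A q) * (∑ q, c q • A q)ᴴ) ^ p).trace.re)
              (Measure.pi fun _ : ι => complexNormal 1) := (integrable_trace_pow A p).re
          rw [← integral_const_mul, ofReal_integral_eq_lintegral_ofReal (hint.const_mul _)
            (Filter.Eventually.of_forall fun c => mul_nonneg (by positivity) (hnn c))]
      _ ≤ ENNReal.ofReal (1 / ((2 * s) ^ p * p.factorial)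
          * (p.factorial * s ^ p * Fintype.card m)) := by
          refine ENNReal.ofReal_le_ofReal (mul_le_mul_of_nonneg_left
            (integral_re_trace_pow_le A s hs.le h1 h2 p) (by positivity))
      _ = _ := by
          congr 1
          have : (p.factorial : ℝ) ≠ 0 := by positivity
          rw [mul_pow, one_div_pow]
          field_simp
  refine (ENNReal.tsum_le_tsum hterm).trans (le_of_eq ?_)
  rw [← ENNReal.ofReal_tsum_of_nonneg (fun p => by positivity)
    (summable_geometric_two.mul_right _), tsum_mul_right, tsum_geometric_two]

/-- Tail bound for the operator norm of a complex Gaussian matrix series. -/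
theorem measure_le_sq_l2_opNorm (hs : 0 < s)
    (h1 : ((s : ℂ) • (1 : Matrix m m ℂ) - ∑ q, A q * (A q)ᴴ).PosSemidef)
    (h2 : ((s : ℂ) • (1 : Matrix n n ℂ) - ∑ q, (A q)ᴴ * A q).PosSemidef) (t : ℝ) :
    Measure.pi (fun _ : ι => complexNormal 1) {c | t ≤ ‖∑ q, c q • A q‖ ^ 2}
      ≤ ENNReal.ofReal (2 * Fintype.card m * Real.exp (-(t / (2 * s)))) := by
  have hmeas : Measurable fun c : ι → ℂ => ‖∑ q, c q • A q‖ :=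
    (by fun_prop : Continuous fun c : ι → ℂ => ‖∑ q, c q • A q‖).measurable
  have hsub : {c : ι → ℂ | t ≤ ‖∑ q, c q • A q‖ ^ 2} ⊆
      {c | ENNReal.ofReal (Real.exp (t / (2 * s)))
        ≤ ENNReal.ofReal (Real.exp (‖∑ q, c q • A q‖ ^ 2 / (2 * s)))} := by
    intro c hc
    simp only [Set.mem_ofPred_eq] at hc ⊢
    gcongr
  refine (measure_mono hsub).trans ((meas_ge_le_lintegral_div
    (Real.measurable_exp.comp ((hmeas.pow_const 2).div_const _)).ennreal_ofReal.aemeasurable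
    ?_ ?_).trans ?_)
  · simpa using Real.exp_pos _
  · exact ENNReal.ofReal_ne_top
  · rw [Real.exp_neg, ← div_eq_mul_inv, ENNReal.ofReal_div_of_pos (Real.exp_pos _)]
    exact ENNReal.div_le_div_right (lintegral_exp_sq_l2_opNorm_le A hs h1 h2) _

end Tail

/-! ### The matrix of `𝒜` and its variance parameters. -/

section Measurement

open scoped ComplexOrder Matrix.Norms.L2Operator

variable {r L : ℕ} {K N : Fin r → ℕ}

/-- The coefficient matrix of the Gaussian entry with index `q` in the matrix of `𝒜`. -/
def coeffMatrix (B : ∀ i, Matrix (Fin L) (Fin (K i)) ℂ)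
    (q : (i : Fin r) × (Fin L × Fin (N i))) :
    Matrix (Fin L) ((i : Fin r) × (Fin (K i) × Fin (N i))) ℂ :=
  Matrix.of fun l p =>
    if q = ⟨p.1, (l, p.2.2)⟩ then B p.1 l p.2.1 else 0

variable (B : ∀ i, Matrix (Fin L) (Fin (K i)) ℂ)

lemma sum_smul_coeffMatrix_apply (c : ((i : Fin r) × (Fin L × Fin (N i))) → ℂ) (l : Fin L)
    (p : (i : Fin r) × (Fin (K i) × Fin (N i))) :
    (∑ q, c q • coeffMatrix B q) l p = c ⟨p.1, (l, p.2.2)⟩ * B p.1 l p.2.1 := by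
  simp [coeffMatrix, Matrix.sum_apply]

lemma measurementOp_apply (C : ∀ i, Matrix (Fin L) (Fin (N i)) ℂ) (Z : LiftedSpace K N) :
    (measurementOp B C Z).ofLp
      = (∑ q : (i : Fin r) × (Fin L × Fin (N i)), C q.1 q.2.1 q.2.2 • coeffMatrix B q)
        *ᵥ fun p => Z p.1 p.2 := by
  ext l
  simp only [Matrix.mulVec, dotProduct, sum_smul_coeffMatrix_apply, Fintype.sum_sigma,
    Fintype.sum_prod_type]
  simp [measurementOp, blockOp, dotProduct, Matrix.mulVec, bVec, cVec, FrobMatrix.toMatrix,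
    Finset.mul_sum]
  refine Finset.sum_congr rfl fun i _ => Finset.sum_congr rfl fun a _ =>
    Finset.sum_congr rfl fun j _ => ?_
  ring

/-- The norm on tuples is the Euclidean norm of the flattened vector of all entries, so the matrix
norm bounds the operator. -/
lemma norm_measurementOp_le (C : ∀ i, Matrix (Fin L) (Fin (N i)) ℂ) :
    ‖measurementOp B C‖
      ≤ ‖∑ q : (i : Fin r) × (Fin L × Fin (N i)), C q.1 q.2.1 q.2.2 • coeffMatrix B q‖ := by
  refine ContinuousLinearMap.opNorm_le_bound _ (norm_nonneg _) fun Z => ?_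
  set M := ∑ q : (i : Fin r) × (Fin L × Fin (N i)), C q.1 q.2.1 q.2.2 • coeffMatrix B q
  have hZ : ‖(WithLp.toLp 2 fun p => Z p.1 p.2 :
      EuclideanSpace ℂ ((i : Fin r) × (Fin (K i) × Fin (N i))))‖ = ‖Z‖ := by
    rw [EuclideanSpace.norm_eq, PiLp.norm_eq_of_L2, Fintype.sum_sigma]
    simp_rw [EuclideanSpace.norm_sq_eq]
  have h := Matrix.l2_opNorm_mulVec M (WithLp.toLp 2 fun p => Z p.1 p.2)
  rw [hZ] at h
  rw [← WithLp.toLp_ofLp 2 (measurementOp B C Z), measurementOp_apply]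
  exact h

/-- For fixed `(i, j)`, summing over the rows `l` produces the block `(B i)ᴴ * B i = 1`; different
pairs `(i, j)` occupy disjoint columns. -/
lemma sum_coeffMatrix_conjTranspose_mul (hB : ∀ i, (B i)ᴴ * B i = 1) :
    ∑ q : (i : Fin r) × (Fin L × Fin (N i)), (coeffMatrix B q)ᴴ * coeffMatrix B q = 1 := by
  ext ⟨i, a, j⟩ ⟨i', a', j'⟩
  simp only [Matrix.sum_apply, Matrix.mul_apply, Matrix.conjTranspose_apply, coeffMatrix,
    Matrix.of_apply]
  rw [Finset.sum_comm]
  simp only [apply_ite star, star_zero, ite_mul, zero_mul, Finset.sum_ite_eq', Finset.mem_univ,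
    if_true]
  by_cases h : i = i'
  · subst h
    have hB' := congrFun (congrFun (hB i) a) a'
    simp only [Matrix.mul_apply, Matrix.conjTranspose_apply] at hB'
    by_cases hj : j = j'
    · subst hj
      simpa [Matrix.one_apply] using hB'
    · simp [hj]
  · simp [h]

/-- For `q = (i, l, j)` the product is `‖b_{i,l}‖²` times the diagonal matrix unit at `l`, and `j`
takes `N i` values. -/
lemma sum_coeffMatrix_mul_conjTranspose :
    ∑ q : (i : Fin r) × (Fin L × Fin (N i)), coeffMatrix B q * (coeffMatrix B q)ᴴ
      = Matrix.diagonal fun l => ((∑ i, (N i : ℝ) * ‖bVec (B i) l‖ ^ 2 : ℝ) : ℂ) := by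
  ext l l'
  simp only [Matrix.sum_apply, Matrix.mul_apply, Matrix.conjTranspose_apply, coeffMatrix,
    Matrix.of_apply]
  rw [Finset.sum_comm]
  simp only [ite_mul, zero_mul, Finset.sum_ite_eq', Finset.mem_univ, if_true]
  by_cases h : l = l'
  · subst h
    simp only [if_true, Matrix.diagonal_apply_eq, Fintype.sum_sigma, Fintype.sum_prod_type]
    push_cast
    refine Finset.sum_congr rfl fun i _ => ?_
    have : ((‖bVec (B i) l‖ ^ 2 : ℝ) : ℂ) = ∑ a, B i l a * star (B i l a) := by
      rw [EuclideanSpace.norm_sq_eq]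
      push_cast
      refine Finset.sum_congr rfl fun a _ => ?_
      simp [bVec, Complex.mul_conj, Complex.normSq_eq_norm_sq]
    push_cast at this
    rw [this, Finset.mul_sum]
    simp
  · simp [h]

lemma mul_norm_bVec_sq_le_maxCoherence (hK : ∀ i, 0 < K i) (i : Fin r) (l : Fin L) :
    (L : ℝ) * ‖bVec (B i) l‖ ^ 2 ≤ maxCoherence B := by
  have hK' : (0 : ℝ) < K i := by exact_mod_cast hK i
  have h1 : (L : ℝ) / K i * ‖bVec (B i) l‖ ^ 2 ≤ coherenceSq (B i) :=
    le_ciSup (f := fun l => (L : ℝ) / K i * ‖bVec (B i) l‖ ^ 2) (Set.finite_range _).bddAbove l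
  have h2 : (K i : ℝ) * coherenceSq (B i) ≤ maxCoherence B :=
    le_ciSup (f := fun i => (K i : ℝ) * coherenceSq (B i)) (Set.finite_range _).bddAbove i
  refine le_trans ?_ h2
  refine le_trans (le_of_eq ?_) (mul_le_mul_of_nonneg_left h1 hK'.le)
  field_simp

lemma sum_mul_norm_bVec_sq_le (hL : 0 < L) (hK : ∀ i, 0 < K i) (l : Fin L) :
    ∑ i, (N i : ℝ) * ‖bVec (B i) l‖ ^ 2
      ≤ (r : ℝ) * maxCoherence B * (maxDim N : ℝ) / (L : ℝ) := by
  have hL' : (0 : ℝ) < L := by exact_mod_cast hL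
  have h : ∀ i ∈ Finset.univ, (N i : ℝ) * ‖bVec (B i) l‖ ^ 2
      ≤ (maxDim N : ℝ) * (maxCoherence B / L) := by
    intro i _
    have hN : (N i : ℝ) ≤ maxDim N := by
      exact_mod_cast Finset.le_sup (f := N) (Finset.mem_univ i)
    refine mul_le_mul hN ?_ (sq_nonneg _) (Nat.cast_nonneg _)
    rw [le_div_iff₀ hL', mul_comm]
    exact mul_norm_bVec_sq_le_maxCoherence B hK i l
  refine (Finset.sum_le_sum h).trans (le_of_eq ?_)
  rw [Finset.sum_const, Finset.card_univ, Fintype.card_fin, nsmul_eq_mul]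
  ring

end Measurement

/-! ### The final numerical estimate and the conclusion. -/

lemma two_mul_exp_neg_logb_le {L d w : ℝ} (hL : 1 ≤ L) (hd : L ≤ d) (hw : 1 ≤ w) :
    2 * L * Real.exp (-(2 * w * Real.logb 2 d)) ≤ 2 * L ^ (-w) := by
  have hL0 : 0 < L := by linarith
  have hlogL : 0 ≤ Real.log L := Real.log_nonneg hL
  have hlog : Real.log L ≤ Real.log d := Real.log_le_log hL0 hd
  have hlogb : Real.log d ≤ Real.logb 2 d := by
    rw [Real.logb, le_div_iff₀ (Real.log_pos one_lt_two)]
    have : Real.log 2 ≤ 1 := by linarith [Real.log_two_lt_d9]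
    nlinarith
  rw [Real.rpow_def_of_pos hL0, mul_assoc]
  refine mul_le_mul_of_nonneg_left ?_ zero_le_two
  conv_lhs => rw [← Real.exp_log hL0, ← Real.exp_add]
  rw [Real.exp_le_exp]
  -- With `log₂ d ≥ log L ≥ 0` and `w ≥ 1`, the claim follows from `(1 + w) log L ≤ 2w log L`: half
  -- of the exponent absorbs the prefactor `L`.
  nlinarith

end BlindDemixing

theorem mainTheorem6 {Ω : Type*} [MeasurableSpace Ω] (P : Measure Ω) [IsProbabilityMeasure P]
    {r L : ℕ} {K N : Fin r → ℕ} (hr : 0 < r) (hK : ∀ i, 0 < K i) (hN : ∀ i, 0 < N i)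
    (B : ∀ i, Matrix (Fin L) (Fin (K i)) ℂ) (hB : ∀ i, (B i)ᴴ * B i = 1)
    (C : Ω → ∀ i, Matrix (Fin L) (Fin (N i)) ℂ)
    (hC_law : ∀ i l j, HasLaw (fun x => C x i l j) (BlindDemixing.complexNormal 1) P)
    (hC_indep : iIndepFun
      (fun (q : (i : Fin r) × (Fin L × Fin (N i))) (x : Ω) => C x q.1 q.2.1 q.2.2) P)
    (w : ℝ) (hw : 1 ≤ w) :
    1 - 2 * (L : ℝ) ^ (-w) ≤
      P.real {x | ‖BlindDemixing.measurementOp B (C x)‖ ≤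
        2 * √(w * max 1 ((r : ℝ) * BlindDemixing.maxCoherence B *
              (BlindDemixing.maxDim N : ℝ) / (L : ℝ)) *
            Real.logb 2 ((L : ℝ) + (r : ℝ) * (BlindDemixing.maxDim K : ℝ) *
              (BlindDemixing.maxDim N : ℝ)))} := by
  open BlindDemixing in
  open scoped ComplexOrder Matrix.Norms.L2Operator in
  have hL : 0 < L := by
    -- With `L = 0` the product `(B i)ᴴ * B i` is zero, yet it is an identity matrix of positive
    -- size.
    by_contra h
    obtain rfl : L = 0 := by omega
    have h1 := congrFun (congrFun (hB ⟨0, hr⟩) ⟨0, hK _⟩) ⟨0, hK _⟩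
    simp [Matrix.mul_apply] at h1
  have hL1 : (1 : ℝ) ≤ L := by exact_mod_cast hL
  have : Nonempty (Fin L) := ⟨⟨0, hL⟩⟩
  set s : ℝ := max 1 ((r : ℝ) * maxCoherence B * (maxDim N : ℝ) / (L : ℝ))
  set d : ℝ := (L : ℝ) + (r : ℝ) * (maxDim K : ℝ) * (maxDim N : ℝ)
  have hs1 : 1 ≤ s := le_max_left _ _
  have hs : 0 < s := by linarith
  have hd : (L : ℝ) ≤ d := le_add_of_nonneg_right (by positivity)
  have hlog : 0 ≤ Real.logb 2 d := Real.logb_nonneg one_lt_two (hL1.trans hd)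
  have h1 : ((s : ℂ) • (1 : Matrix (Fin L) (Fin L) ℂ)
      - ∑ q : (i : Fin r) × (Fin L × Fin (N i)),
        coeffMatrix B q * (coeffMatrix B q)ᴴ).PosSemidef := by
    rw [sum_coeffMatrix_mul_conjTranspose, ← Matrix.diagonal_one, ← Matrix.diagonal_smul,
      Matrix.diagonal_sub, Matrix.posSemidef_diagonal_iff]
    intro l
    have := (sum_mul_norm_bVec_sq_le (N := N) B hL hK l).trans (le_max_right 1 _)
    simp only [Pi.smul_apply, smul_eq_mul, mul_one, ← Complex.ofReal_sub]
    exact_mod_cast sub_nonneg.2 this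
  have h2 : ((s : ℂ) • (1 : Matrix ((i : Fin r) × (Fin (K i) × Fin (N i)))
      ((i : Fin r) × (Fin (K i) × Fin (N i))) ℂ)
      - ∑ q : (i : Fin r) × (Fin L × Fin (N i)),
        (coeffMatrix B q)ᴴ * coeffMatrix B q).PosSemidef := by
    rw [sum_coeffMatrix_conjTranspose_mul B hB]
    have h : (s : ℂ) • (1 : Matrix ((i : Fin r) × (Fin (K i) × Fin (N i)))
        ((i : Fin r) × (Fin (K i) × Fin (N i))) ℂ) - 1 = ((s - 1 : ℝ) : ℂ) • 1 := by
      rw [Complex.ofReal_sub, sub_smul, Complex.ofReal_one, one_smul]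
    rw [h]
    exact Matrix.PosSemidef.one.smul (by exact_mod_cast sub_nonneg.2 hs1)
  -- The threshold is the square of the claimed bound, so that `t / (2 * s) = 2 * w * Real.logb 2
  -- d`.
  have htail := measure_le_sq_l2_opNorm (coeffMatrix B) hs h1 h2 (4 * (w * s * Real.logb 2 d))
  have haem : ∀ q : (i : Fin r) × (Fin L × Fin (N i)),
      AEMeasurable (fun x => C x q.1 q.2.1 q.2.2) P := fun q => (hC_law q.1 q.2.1 q.2.2).aemeasurable
  have hmap : P.map (fun x (q : (i : Fin r) × (Fin L × Fin (N i))) => C x q.1 q.2.1 q.2.2)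
      = Measure.pi (fun _ => complexNormal 1) := by
    rw [(iIndepFun_iff_map_fun_eq_pi_map haem).1 hC_indep]
    congr 1
    ext1 q
    exact (hC_law q.1 q.2.1 q.2.2).map_eq
  have hmeas : Measurable fun c : ((i : Fin r) × (Fin L × Fin (N i))) → ℂ =>
      ‖∑ q, c q • coeffMatrix B q‖ :=
    (by fun_prop : Continuous fun c : ((i : Fin r) × (Fin L × Fin (N i))) → ℂ =>
      ‖∑ q, c q • coeffMatrix B q‖).measurable
  rw [← hmap, Measure.map_apply_of_aemeasurable (aemeasurable_pi_lambda _ haem)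
    (measurableSet_le measurable_const (hmeas.pow_const 2))] at htail
  set bad : Set Ω := (fun x (q : (i : Fin r) × (Fin L × Fin (N i))) => C x q.1 q.2.1 q.2.2) ⁻¹'
    {c | 4 * (w * s * Real.logb 2 d) ≤ ‖∑ q, c q • coeffMatrix B q‖ ^ 2}
  set good : Set Ω := {x | ‖measurementOp B (C x)‖ ≤ 2 * √(w * s * Real.logb 2 d)}
  -- A cover and subadditivity suffice, so measurability of `good` is not needed.
  have hcover : Set.univ ⊆ good ∪ bad := by
    intro x _
    by_contra hx
    rw [Set.mem_union, not_or] at hx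
    obtain ⟨hgood, hbad⟩ := hx
    refine hgood ?_
    have hlt : ‖∑ q : (i : Fin r) × (Fin L × Fin (N i)),
        C x q.1 q.2.1 q.2.2 • coeffMatrix B q‖ ^ 2 < 4 * (w * s * Real.logb 2 d) := not_le.1 hbad
    refine (norm_measurementOp_le B (C x)).trans (abs_le_of_sq_le_sq' ?_ (by positivity)).2
    rw [mul_pow, Real.sq_sqrt (by positivity)]
    linarith
  have hbad : P.real bad ≤ 2 * (L : ℝ) ^ (-w) := by
    have h := ENNReal.toReal_mono ENNReal.ofReal_ne_top htail
    rw [ENNReal.toReal_ofReal (by positivity), Fintype.card_fin] at h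
    refine h.trans (le_trans (le_of_eq ?_) (two_mul_exp_neg_logb_le hL1 hd hw))
    congr 3
    field_simp
    ring
  have hone : (1 : ℝ) ≤ P.real good + P.real bad := by
    rw [← probReal_univ (μ := P)]
    exact (measureReal_mono hcover).trans (measureReal_union_le _ _)
  linarith
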